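/- **Corollary 6.2 (free Leech theorem).** Let $d\in\mathbb N$, let $\mathbb B^d_n$ be the set of $d$-tuples $Z=(Z_1,\dots,Z_d)$ of complex $n\times n$ matrices whose row $[Z_1\ \cdots\ Z_d]:\mathbb C^n\otimes\mathbb C^d\to\mathbb C^n$ has operator norm $<1$, and let $\mathbb B^d_{\mathbb N}=\bigsqcup_{n\ge1}\mathbb B^d_n$. For $Z\in\mathbb B^d_n$, $W\in\mathbb B^d_m$, $P\in\mathbb C^{n\times m}$ let $$K(Z,W)[P]=\sum_{\alpha}Z^\alpha P\,(W^\alpha)^*$$ be the free Szegő kernel, the sum being over all words $\alpha$ in $d$ letters; for a Hilbert space $J$ the same formula, with $Z^\alpha$ and $W^\alpha$ replaced by $Z^\alpha\otimes I_J$ and $W^\alpha\otimes I_J$, defines $(K(Z,W)\otimes\mathrm{id}_J)[Q]$ for $Q\in\mathbb C^{n\times m}\otimes\mathcal L(J)$. A function $f$ on $\mathbb B^d_{\mathbb N}$ with values $f(Z)\in\mathbb C^{n\times n}\otimes V$ for $Z\in\mathbb B^d_n$ is *free* if $f(Z)X=Xf(W)$ whenever $X\in\mathbb C^{n\times m}$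 and $Z_kX=XW_k$ for all $k$. A kernel $G$ assigning to $Z\in\mathbb B^d_n$, $W\in\mathbb B^d_m$ a linear map $G(Z,W):\mathbb C^{n\times m}\to\mathbb C^{n\times m}\otimes\mathcal L(J)$ is *CPNC* (completely positive noncommutative) if $X\,G(Z,W)[P]\,Y^*=G(Z',W')[XPY^*]$ whenever $XZ_k=Z'_kX$ and $YW_k=W'_kY$ for all $k$, and $G(Z,Z)[P]\ge0$ for all $Z\in\mathbb B^d_n$, $n\ge1$, and all $P\ge0$ in $\mathbb C^{n\times n}$. For a Hilbert space $H$ let $H^2(\mathbb B^d_{\mathbb N})\otimes H$ be the Hilbert space of functions $f(Z)=\sum_\alpha Z^\alpha\otimes x_\alpha$, $x_\alpha\in H$, with $\|f\|^2=\sum_\alpha\|x_\alpha\|^2<\infty$. Let $\bullet_R$ be the right product, determined by bilinearity and $(f\otimes Y)\bullet_R(g\otimes X)=gf\otimes YX$ for $f,g\in\mathbb C^{n\times n}$ and $Y$ an operator, $X$ an operator or a vector such that $YX$ makes sense. A free function $C$ with values in $\mathbb C^{n\times n}\otimes\mathcal L(H_1,H_2)$ on $\mathbb B^d_n$ is a *left*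 (respectively *right*) *free Schur multiplier* if $f\mapsto Cf$ (respectively $f\mapsto C\bullet_Rf$, taken pointwise) maps $H^2(\mathbb B^d_{\mathbb N})\otimes H_1$ contractively into $H^2(\mathbb B^d_{\mathbb N})\otimes H_2$. Let $H_1,H_2,J$ be complex Hilbert spaces, and let $A$ and $B$ be free functions on $\mathbb B^d_{\mathbb N}$ with values, on $\mathbb B^d_n$, in $\mathbb C^{n\times n}\otimes\mathcal L(H_1,J)$ and $\mathbb C^{n\times n}\otimes\mathcal L(H_2,J)$ respectively. 1. If $$B(Z)\bigl(K(Z,W)[\,\cdot\,]\otimes I_{H_2}\bigr)B(W)^*-A(Z)\bigl(K(Z,W)[\,\cdot\,]\otimes I_{H_1}\bigr)A(W)^*$$ is a CPNC kernel, then there is a left free Schur multiplier $C$, with values in $\mathbb C^{n\times n}\otimes\mathcal L(H_1,H_2)$, such that $A(Z)=B(Z)C(Z)$ for all $Z\in\mathbb B^d_{\mathbb N}$. 2. If $$(K(Z,W)\otimes\mathrm{id}_J)\bigl[B(Z)([\,\cdot\,]\otimes I_{H_2})B(W)^*\bigr]-(K(Z,W)\otimes\mathrm{id}_J)\bigl[A(Z)([\,\cdot\,]\otimes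 I_{H_1})A(W)^*\bigr]$$ is a CPNC kernel, then there is a right free Schur multiplier $C$, with values in $\mathbb C^{n\times n}\otimes\mathcal L(H_1,H_2)$, such that $A(Z)=B(Z)\bullet_RC(Z)$ for all $Z\in\mathbb B^d_{\mathbb N}$. -/

import Mathlib

noncomputable section

namespace FreeHardy

open scoped Matrix

/-- The row matrix `[Z_1 ⋯ Z_d]`, i.e. the row operator `ℂⁿ ⊗ ℂᵈ → ℂⁿ` attached to a `d`-tuple
of `n × n` complex matrices. -/
def rowMatrix {d n : ℕ} (Z : Fin d → Matrix (Fin n) (Fin n) ℂ) :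
    Matrix (Fin n) (Fin d × Fin n) ℂ :=
  Matrix.of fun i p => Z p.1 i p.2

open scoped Matrix.Norms.L2Operator in
/-- The `n`-th level `𝔹ᵈₙ` of the open noncommutative unit ball: strict row contractions on `ℂⁿ`
(the norm is the operator norm between Euclidean spaces).  The level `n = 0` is a single point at
which every matrix is empty, so that it carries no information. -/
def Ball (d n : ℕ) : Type :=
  {Z : Fin d → Matrix (Fin n) (Fin n) ℂ // ‖rowMatrix Z‖ < 1}

/-- The monomial `Z^α = Z_{i₁} ⋯ Z_{iₖ}` for a word `α = i₁ ⋯ iₖ` in the free monoid. -/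
def Ball.word {d n : ℕ} (Z : Ball d n) (α : FreeMonoid (Fin d)) : Matrix (Fin n) (Fin n) ℂ :=
  FreeMonoid.lift Z.1 α

section MatrixOps

variable {V : Type*} [AddCommGroup V] [Module ℂ V]

/-- `X ⬝ T` for a scalar matrix `X` and a `V`-valued matrix `T`: the action of `X ⊗ I`. -/
def scalarMul {l m n : ℕ} (X : Matrix (Fin l) (Fin m) ℂ) (T : Matrix (Fin m) (Fin n) V) :
    Matrix (Fin l) (Fin n) V :=
  Matrix.of fun i j => ∑ k, X i k • T k j

/-- `T ⬝ X` for a `V`-valued matrix `T` and a scalar matrix `X`: the right action of `X ⊗ I`. -/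
def mulScalar {l m n : ℕ} (T : Matrix (Fin l) (Fin m) V) (X : Matrix (Fin m) (Fin n) ℂ) :
    Matrix (Fin l) (Fin n) V :=
  Matrix.of fun i j => ∑ k, X k j • T i k

/-- A graded function on the noncommutative ball with values in
`V_nc = ⨆ₙ ℂ^{n×n} ⊗ V = ⨆ₙ V^{n×n}`. -/
abbrev GradedFun (d : ℕ) (V : Type*) : Type _ :=
  ∀ n : ℕ, Ball d n → Matrix (Fin n) (Fin n) V

/-- A free (noncommutative) function: a graded function that respects intertwinings. -/
def IsFree {d : ℕ} (f : GradedFun d V) : Prop :=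
  ∀ (n m : ℕ) (Z : Ball d n) (W : Ball d m) (X : Matrix (Fin n) (Fin m) ℂ),
    (∀ k, Z.1 k * X = X * W.1 k) → mulScalar (f n Z) X = scalarMul X (f m W)

end MatrixOps

/-- The noncommutative Szegő kernel with its amplifications,
`(K(Z, W) ⊗ id_V)[Q] = ∑_α Z^α Q (W^α)*`, for `Q ∈ ℂ^{n×m} ⊗ V = V^{n×m}`
(note that `(W*)^{α†} = (W^α)*`).  For `V = ℂ` this is the Szegő kernel `K(Z, W)[Q]` itself. -/
def szego {V : Type*} [NormedAddCommGroup V] [NormedSpace ℂ V] {d n m : ℕ}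
    (Z : Ball d n) (W : Ball d m) (Q : Matrix (Fin n) (Fin m) V) : Matrix (Fin n) (Fin m) V :=
  ∑' α : FreeMonoid (Fin d), mulScalar (scalarMul (Z.word α) Q) (W.word α)ᴴ

section Operators

variable {H H₁ H₂ J : Type*}
  [NormedAddCommGroup H] [InnerProductSpace ℂ H]
  [NormedAddCommGroup H₁] [InnerProductSpace ℂ H₁]
  [NormedAddCommGroup H₂] [InnerProductSpace ℂ H₂]
  [NormedAddCommGroup J] [InnerProductSpace ℂ J]

/-- The usual product of operator matrices, `(S T)_{ij} = ∑_k S_{ik} T_{kj}`; on elementary tensors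
`(f ⊗ Y)(g ⊗ X) = f g ⊗ Y X`. -/
def opMul {l m n : ℕ} (S : Matrix (Fin l) (Fin m) (H₂ →L[ℂ] J))
    (T : Matrix (Fin m) (Fin n) (H₁ →L[ℂ] H₂)) : Matrix (Fin l) (Fin n) (H₁ →L[ℂ] J) :=
  Matrix.of fun i j => ∑ k, (S i k).comp (T k j)

/-- The right product `S •_R T` of operator matrices, `(S •_R T)_{ij} = ∑_k S_{kj} T_{ik}`; on
elementary tensors `(f ⊗ Y) •_R (g ⊗ X) = g f ⊗ Y X`. -/
def opMulRight {n : ℕ} (S : Matrix (Fin n) (Fin n) (H₂ →L[ℂ] J))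
    (T : Matrix (Fin n) (Fin n) (H₁ →L[ℂ] H₂)) : Matrix (Fin n) (Fin n) (H₁ →L[ℂ] J) :=
  Matrix.of fun i j => ∑ k, (S k j).comp (T i k)

/-- The product of an operator matrix and a vector-valued matrix; on elementary tensors
`(f ⊗ Y)(g ⊗ h) = f g ⊗ Y h`. -/
def opApply {n : ℕ} (S : Matrix (Fin n) (Fin n) (H →L[ℂ] J))
    (x : Matrix (Fin n) (Fin n) H) : Matrix (Fin n) (Fin n) J :=
  Matrix.of fun i j => ∑ k, S i k (x k j)

/-- The right product of an operator matrix and a vector-valued matrix; on elementary tensors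
`(f ⊗ Y) •_R (g ⊗ h) = g f ⊗ Y h`. -/
def opApplyRight {n : ℕ} (S : Matrix (Fin n) (Fin n) (H →L[ℂ] J))
    (x : Matrix (Fin n) (Fin n) H) : Matrix (Fin n) (Fin n) J :=
  Matrix.of fun i j => ∑ k, S k j (x i k)

/-- The adjoint of an operator matrix. -/
def opAdjoint [CompleteSpace H] [CompleteSpace J] {n m : ℕ}
    (S : Matrix (Fin n) (Fin m) (H →L[ℂ] J)) : Matrix (Fin m) (Fin n) (J →L[ℂ] H) :=
  Matrix.of fun i j => ContinuousLinearMap.adjoint (S j i)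

/-! ### Completely positive noncommutative kernels -/

/-- A graded kernel on the noncommutative ball: `K(Z, W)` maps `ℂ^{n×m}` to `ℒ(J)^{n×m}`. -/
abbrev GradedKernel (d : ℕ) (J : Type*) [NormedAddCommGroup J] [InnerProductSpace ℂ J] : Type _ :=
  ∀ n m : ℕ, Ball d n → Ball d m → Matrix (Fin n) (Fin m) ℂ → Matrix (Fin n) (Fin m) (J →L[ℂ] J)

open scoped ComplexOrder in
/-- `K` is a completely positive noncommutative (CPNC) kernel: every `K(Z, W)` is linear, `K`
respects intertwinings in both arguments, and `K(Z, Z)` maps positive semi-definite matrices to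
positive semi-definite operators on `ℂⁿ ⊗ J = Jⁿ` at every point `Z` (of every level, so that
`K(Z, Z)` is completely positive, the ball being closed under direct sums). -/
structure IsCPNC {d : ℕ} (K : GradedKernel d J) : Prop where
  map_add : ∀ (n m : ℕ) (Z : Ball d n) (W : Ball d m) (P Q : Matrix (Fin n) (Fin m) ℂ),
    K n m Z W (P + Q) = K n m Z W P + K n m Z W Q
  map_smul : ∀ (n m : ℕ) (Z : Ball d n) (W : Ball d m) (c : ℂ) (P : Matrix (Fin n) (Fin m) ℂ),
    K n m Z W (c • P) = c • K n m Z W P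
  intertwine : ∀ (n m n' m' : ℕ) (Z : Ball d n) (W : Ball d m) (Z' : Ball d n') (W' : Ball d m')
    (X : Matrix (Fin n') (Fin n) ℂ) (Y : Matrix (Fin m') (Fin m) ℂ)
    (P : Matrix (Fin n) (Fin m) ℂ),
    (∀ k, X * Z.1 k = Z'.1 k * X) → (∀ k, Y * W.1 k = W'.1 k * Y) →
      mulScalar (scalarMul X (K n m Z W P)) Yᴴ = K n' m' Z' W' (X * P * Yᴴ)
  pos : ∀ (n : ℕ) (Z : Ball d n) (P : Matrix (Fin n) (Fin n) ℂ), P.PosSemidef →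
    ∀ y : Fin n → J, 0 ≤ ∑ i, ∑ j, inner ℂ (y i) (K n n Z Z P i j (y j))

/-- The kernel `A(Z) (K(Z, W)[P] ⊗ I_H) A(W)*`, with `K` the noncommutative Szegő kernel. -/
def leftKernel [CompleteSpace H] [CompleteSpace J] {d : ℕ} (A : GradedFun d (H →L[ℂ] J)) :
    GradedKernel d J :=
  fun n m Z W P => opMul (mulScalar (A n Z) (szego Z W P)) (opAdjoint (A m W))

/-- The kernel `(K(Z, W) ⊗ id_J)[A(Z) (P ⊗ I_H) A(W)*]`, with `K` the noncommutative Szegő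
kernel. -/
def rightKernel [CompleteSpace H] [CompleteSpace J] {d : ℕ} (A : GradedFun d (H →L[ℂ] J)) :
    GradedKernel d J :=
  fun n m Z W P => szego Z W (opMul (mulScalar (A n Z) P) (opAdjoint (A m W)))

/-! ### Vector-valued free Hardy spaces and Schur multipliers -/

/-- The vector-valued Fock space `F²_d ⊗ H`, in coordinates with respect to the orthonormal basis
`e_α` of `F²_d`: square-summable families `(x_α)` of vectors of `H` indexed by words. -/
abbrev Fock (d : ℕ) (H : Type*) [NormedAddCommGroup H] [InnerProductSpace ℂ H] : Type _ :=
  lp (fun _ : FreeMonoid (Fin d) => H) 2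

/-- The canonical identification of `F²_d ⊗ H` with the free Hardy space `H²(𝔹ᵈ_ℕ) ⊗ H`: the vector
`x` is the `H`-valued free function `f_x(Z) = ∑_α Z^α ⊗ x_α`, with norm `‖f_x‖ = ‖x‖`. -/
def Fock.eval {d : ℕ} (x : Fock d H) : GradedFun d H :=
  fun _ Z => ∑' α : FreeMonoid (Fin d), Matrix.of fun i j => Z.word α i j • x α

/-- The left operator-valued Schur class `ℒ_d(H, J)`: free functions `C` such that `f ↦ C f` maps
`H²(𝔹ᵈ_ℕ) ⊗ H` contractively into `H²(𝔹ᵈ_ℕ) ⊗ J`. -/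
def IsLeftSchur {d : ℕ} (C : GradedFun d (H →L[ℂ] J)) : Prop :=
  IsFree C ∧ ∀ x : Fock d H, ∃ y : Fock d J, ‖y‖ ≤ ‖x‖ ∧
    ∀ (n : ℕ) (Z : Ball d n), opApply (C n Z) (x.eval n Z) = y.eval n Z

/-- The right operator-valued Schur class, in terms of the function by which one multiplies: free
functions `C` such that right multiplication `f ↦ C •_R f` maps `H²(𝔹ᵈ_ℕ) ⊗ H` contractively into
`H²(𝔹ᵈ_ℕ) ⊗ J`. -/
def IsRightSchur {d : ℕ} (C : GradedFun d (H →L[ℂ] J)) : Prop :=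
  IsFree C ∧ ∀ x : Fock d H, ∃ y : Fock d J, ‖y‖ ≤ ‖x‖ ∧
    ∀ (n : ℕ) (Z : Ball d n), opApplyRight (C n Z) (x.eval n Z) = y.eval n Z

end Operators

end FreeHardy

end

noncomputable section

namespace FreeHardy

open Filter Topology ComplexConjugate
open scoped Matrix

section ContractiveRelation

variable {E F : Type*} [NormedAddCommGroup E] [InnerProductSpace ℂ E] [CompleteSpace E]
  [NormedAddCommGroup F] [InnerProductSpace ℂ F] [CompleteSpace F]

/-- A contractive linear relation between Hilbert spaces, parametrized by a vector space,
extends to an everywhere defined contraction. -/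
theorem exists_contraction_of_norm_le {M : Type*} [AddCommGroup M] [Module ℂ M]
    (p : M →ₗ[ℂ] E) (q : M →ₗ[ℂ] F) (h : ∀ x, ‖q x‖ ≤ ‖p x‖) :
    ∃ T : E →L[ℂ] F, (∀ x, ‖T x‖ ≤ ‖x‖) ∧ ∀ x, T (p x) = q x := by
  set N := (LinearMap.range p).topologicalClosure with hN
  have hmem : ∀ x, p x ∈ N := fun x =>
    Submodule.le_topologicalClosure _ (LinearMap.mem_range_self p x)
  have : CompleteSpace N :=
    (Submodule.isClosed_topologicalClosure (LinearMap.range p)).completeSpace_coe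
  let p' : M →ₗ[ℂ] N := p.codRestrict N hmem
  have hd : DenseRange p' := by
    rw [DenseRange, Subtype.dense_iff]
    intro x hx
    have h1 : ((↑) : N → E) '' Set.range p' = (LinearMap.range p : Set E) := by
      ext y; simp [p']
    change x ∈ closure (((↑) : N → E) '' Set.range p')
    rw [h1]
    exact hx
  have hb : ∀ x, ‖q x‖ ≤ 1 * ‖p' x‖ := fun x => by simpa [p'] using h x
  refine ⟨(q.extendOfNorm p').comp N.orthogonalProjectionOnto, fun x => ?_, fun x => ?_⟩
  · calc _ ≤ 1 * ‖N.orthogonalProjectionOnto x‖ :=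
          LinearMap.norm_extendOfNorm_apply_le hd 1 hb _
      _ ≤ ‖x‖ := by
          rw [one_mul]; exact N.norm_orthogonalProjectionOnto_apply_le x
  · have h2 : N.orthogonalProjectionOnto (p x) = p' x := by
      exact N.orthogonalProjectionOnto_mem_subspace_eq_self ⟨p x, hmem x⟩
    simp only [ContinuousLinearMap.comp_apply, h2]
    exact LinearMap.extendOfNorm_eq hd ⟨1, hb⟩ x

/-- A defect operator of a contraction `T`, i.e. some `D` with `D* D = 1 - T* T`. -/
theorem exists_defect (T : E →L[ℂ] F) (hT : ∀ x, ‖T x‖ ≤ ‖x‖) :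
    ∃ D : E →L[ℂ] E, ∀ x, ‖T x‖ ^ 2 + ‖D x‖ ^ 2 = ‖x‖ ^ 2 := by
  have hre : ∀ x, RCLike.re (inner ℂ x ((1 - (ContinuousLinearMap.adjoint T).comp T) x))
      = ‖x‖ ^ 2 - ‖T x‖ ^ 2 := by
    intro x
    rw [sub_apply, inner_sub_right, ContinuousLinearMap.comp_apply,
      ContinuousLinearMap.adjoint_inner_right, map_sub, one_apply_eq_self,
      inner_self_eq_norm_sq, inner_self_eq_norm_sq]
  have h0 : 0 ≤ 1 - (ContinuousLinearMap.adjoint T).comp T := by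
    rw [ContinuousLinearMap.nonneg_iff_isPositive, ContinuousLinearMap.isPositive_def']
    refine ⟨(IsSelfAdjoint.one _).sub (ContinuousLinearMap.isPositive_adjoint_comp_self T).isSelfAdjoint, fun x => ?_⟩
    rw [ContinuousLinearMap.reApplyInnerSelf_apply, inner_re_symm, hre]
    have := hT x
    have := norm_nonneg (T x)
    nlinarith
  obtain ⟨D, hD⟩ := CStarAlgebra.nonneg_iff_eq_star_mul_self.1 h0
  refine ⟨D, fun x => ?_⟩
  have h1 := hre x
  rw [hD, mul_apply_eq_comp, ContinuousLinearMap.star_eq_adjoint,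
    ContinuousLinearMap.adjoint_inner_right, inner_self_eq_norm_sq] at h1
  linarith

/-- `exists_contraction_of_norm_le` for orthogonal sums, in coordinates. -/
theorem exists_contraction_of_sum_sq_le {K E' F' : Type*} [Fintype K]
    [NormedAddCommGroup E'] [InnerProductSpace ℂ E'] [CompleteSpace E']
    [NormedAddCommGroup F'] [InnerProductSpace ℂ F'] [CompleteSpace F']
    {M : Type*} [AddCommGroup M] [Module ℂ M]
    (p : M →ₗ[ℂ] E) (p' : K → M →ₗ[ℂ] E') (q : M →ₗ[ℂ] F) (q' : M →ₗ[ℂ] F')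
    (h : ∀ x, ‖q x‖ ^ 2 + ‖q' x‖ ^ 2 ≤ ‖p x‖ ^ 2 + ∑ k, ‖p' k x‖ ^ 2) :
    ∃ (U : E × (K → E') →ₗ[ℂ] F) (V : E × (K → E') →ₗ[ℂ] F'),
      (∀ z, ‖U z‖ ^ 2 + ‖V z‖ ^ 2 ≤ ‖z.1‖ ^ 2 + ∑ k, ‖z.2 k‖ ^ 2) ∧
      ∀ x, U (p x, fun k => p' k x) = q x ∧ V (p x, fun k => p' k x) = q' x := by
  let P₀ : E × (K → E') →ₗ[ℂ] WithLp 2 (E × PiLp 2 fun _ : K => E') :=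
    (WithLp.linearEquiv 2 ℂ _).symm.toLinearMap ∘ₗ
      (LinearMap.id.prodMap (WithLp.linearEquiv 2 ℂ (K → E')).symm.toLinearMap)
  let Q₀ : F × F' →ₗ[ℂ] WithLp 2 (F × F') := (WithLp.linearEquiv 2 ℂ _).symm.toLinearMap
  have hP₀ : ∀ z, ‖P₀ z‖ ^ 2 = ‖z.1‖ ^ 2 + ∑ k, ‖z.2 k‖ ^ 2 := fun z => by
    rw [WithLp.prod_norm_sq_eq_of_L2]
    simp [P₀, PiLp.norm_sq_eq_of_L2]
  have hQ₀ : ∀ z, ‖Q₀ z‖ ^ 2 = ‖z.1‖ ^ 2 + ‖z.2‖ ^ 2 := fun z => by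
    rw [WithLp.prod_norm_sq_eq_of_L2]; simp [Q₀]
  obtain ⟨T, hT, hTx⟩ := exists_contraction_of_norm_le (P₀ ∘ₗ (p.prod (LinearMap.pi p')))
    (Q₀ ∘ₗ (q.prod q')) fun x => by
      refine le_of_sq_le_sq ?_ (norm_nonneg _)
      simpa [hP₀, hQ₀] using h x
  let R := (WithLp.linearEquiv 2 ℂ (F × F')).toLinearMap ∘ₗ T.toLinearMap ∘ₗ P₀
  refine ⟨LinearMap.fst ℂ F F' ∘ₗ R, LinearMap.snd ℂ F F' ∘ₗ R, fun z => ?_, fun x => ?_⟩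
  · rw [← hP₀]
    have h1 := hT (P₀ z)
    calc _ = ‖T (P₀ z)‖ ^ 2 := by rw [WithLp.prod_norm_sq_eq_of_L2]; rfl
      _ ≤ _ := by gcongr
  · have h1 := hTx x
    have h2 : R (p x, fun k => p' k x) = (q x, q' x) := by
      change (T ((P₀ ∘ₗ (p.prod (LinearMap.pi p'))) x)).ofLp = _
      rw [h1]; rfl
    simp [h2]

end ContractiveRelation

section Shift

variable {ι K : Type*} (e : Option (K × ι) ≃ ι)

theorem shiftIndex_injective (k : K) :
    Function.Injective fun i => e (some (k, i)) := by
  intro i j h; simpa using h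

variable {H : Type*} [NormedAddCommGroup H]

theorem memℓp_two_iff_summable_sq {x : ι → H} :
    Memℓp x 2 ↔ Summable fun i => ‖x i‖ ^ 2 := by
  simp [memℓp_gen_iff (p := 2) (by norm_num)]

theorem summable_sq (x : lp (fun _ : ι => H) 2) : Summable fun i => ‖x i‖ ^ 2 :=
  memℓp_two_iff_summable_sq.1 (lp.memℓp x)

theorem norm_sq_eq_tsum (x : lp (fun _ : ι => H) 2) : ‖x‖ ^ 2 = ∑' i, ‖x i‖ ^ 2 := by
  simpa using lp.norm_rpow_eq_tsum (p := 2) (by norm_num) x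

variable [InnerProductSpace ℂ H]

/-- The `k`-th backward shift `(x_i) ↦ (x_{k i})`, for an index set decomposed by `e`. -/
def backShift (k : K) : lp (fun _ : ι => H) 2 →ₗ[ℂ] lp (fun _ : ι => H) 2 where
  toFun x := ⟨fun i => x (e (some (k, i))), memℓp_two_iff_summable_sq.2
    ((summable_sq x).comp_injective (shiftIndex_injective e k))⟩
  map_add' _ _ := rfl
  map_smul' _ _ := rfl

@[simp]
theorem backShift_apply (k : K) (x : lp (fun _ : ι => H) 2) (i : ι) :
    backShift e k x i = x (e (some (k, i))) := rfl

theorem ext_backShift {x y : lp (fun _ : ι => H) 2} (h₀ : x (e none) = y (e none))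
    (h : ∀ k, backShift e k x = backShift e k y) : x = y := by
  ext i
  obtain ⟨o, rfl⟩ := e.surjective i
  rcases o with _ | ⟨k, j⟩
  · exact h₀
  · simpa using congrArg (fun z => z j) (h k)

variable [Fintype K]

theorem hasSum_of_shift {M : Type*} [AddCommMonoid M] [TopologicalSpace M] [ContinuousAdd M]
    (f : ι → M) {a : K → M} (h : ∀ k, HasSum (fun i => f (e (some (k, i)))) (a k)) :
    HasSum f (f (e none) + ∑ k, a k) := by
  classical
  have h1 : HasSum (fun i => if i = e none then f (e none) else 0) (f (e none)) :=
    hasSum_ite_eq (e none) (f (e none))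
  have h2 : ∀ k, HasSum ((Set.range fun i => e (some (k, i))).indicator f) (a k) := by
    intro k
    rw [← hasSum_subtype_iff_indicator]
    exact (shiftIndex_injective e k).hasSum_range_iff.2 (h k)
  convert h1.add (hasSum_sum fun k (_ : k ∈ Finset.univ) => h2 k) using 1
  funext i
  obtain ⟨o, rfl⟩ := e.surjective i
  rcases o with _ | ⟨k, j⟩
  · simp
  · rw [Finset.sum_eq_single k]
    · simp
    · intro b _ hb
      simp [hb]
    · simp

theorem tsum_shift {f : ι → ℝ} (hf : Summable f) :
    ∑' i, f i = f (e none) + ∑ k, ∑' i, f (e (some (k, i))) :=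
  (hasSum_of_shift e f fun k =>
    (hf.comp_injective (shiftIndex_injective e k)).hasSum).tsum_eq

theorem norm_sq_eq_backShift (x : lp (fun _ : ι => H) 2) :
    ‖x‖ ^ 2 = ‖x (e none)‖ ^ 2 + ∑ k, ‖backShift e k x‖ ^ 2 := by
  simp only [norm_sq_eq_tsum, tsum_shift e (summable_sq x), backShift_apply]

/-- Assembles a sequence from its initial entry and its backward shifts. -/
def consShift : H × (K → lp (fun _ : ι => H) 2) →ₗ[ℂ] lp (fun _ : ι => H) 2 where
  toFun z := ⟨fun i => (e.symm i).elim z.1 fun p => z.2 p.1 p.2, memℓp_two_iff_summable_sq.2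
    (hasSum_of_shift e _ (a := fun k => ∑' i, ‖z.2 k i‖ ^ 2) fun k => by
      simpa using (summable_sq (z.2 k)).hasSum).summable⟩
  map_add' z w := by
    ext i
    obtain ⟨o, rfl⟩ := e.surjective i
    change _ = (e.symm (e o)).elim z.1 (fun p => z.2 p.1 p.2) +
      (e.symm (e o)).elim w.1 (fun p => w.2 p.1 p.2)
    rcases o with _ | p <;> simp
  map_smul' c z := by
    ext i
    obtain ⟨o, rfl⟩ := e.surjective i
    rcases o with _ | p <;> simp

@[simp]
theorem consShift_none (z : H × (K → lp (fun _ : ι => H) 2)) :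
    consShift e z (e none) = z.1 := by
  change (e.symm (e none)).elim _ _ = _
  simp

@[simp]
theorem backShift_consShift (z : H × (K → lp (fun _ : ι => H) 2)) (k : K) :
    backShift e k (consShift e z) = z.2 k := by
  ext i
  change (e.symm (e (some (k, i)))).elim _ _ = _
  simp

/-- The squared norm of the part of `x` supported on indices of length at least `n`. -/
def tailSq : ℕ → lp (fun _ : ι => H) 2 → ℝ
  | 0, x => ‖x‖ ^ 2
  | n + 1, x => ∑ k, tailSq n (backShift e k x)

variable {e} {len : ι → ℕ}

theorem tailSq_eq (hlen₀ : len (e none) = 0)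
    (hlen : ∀ k i, len (e (some (k, i))) = len i + 1) (n : ℕ) (x : lp (fun _ : ι => H) 2) :
    tailSq e n x = ∑' i, if n ≤ len i then ‖x i‖ ^ 2 else 0 := by
  induction n generalizing x with
  | zero => simp [tailSq, norm_sq_eq_tsum]
  | succ n ih =>
    have hs : Summable fun i => if n + 1 ≤ len i then ‖x i‖ ^ 2 else 0 :=
      (summable_sq x).of_nonneg_of_le (fun i => by split_ifs <;> positivity)
        (fun i => by split_ifs <;> simp)
    rw [tsum_shift e hs]
    simp [tailSq, ih, hlen₀, hlen]

theorem tendsto_tailSq (hlen₀ : len (e none) = 0)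
    (hlen : ∀ k i, len (e (some (k, i))) = len i + 1) (x : lp (fun _ : ι => H) 2) :
    Tendsto (fun n => tailSq e n x) atTop (𝓝 0) := by
  simp only [tailSq_eq hlen₀ hlen]
  have := tendsto_tsum_of_dominated_convergence (β := ι) (𝓕 := atTop (α := ℕ))
    (f := fun n i => if n ≤ len i then ‖x i‖ ^ 2 else 0) (g := fun _ => (0 : ℝ))
    (bound := fun i => ‖x i‖ ^ 2) (summable_sq x) (fun i => ?_) (.of_forall fun n i => ?_)
  · simpa using this
  · refine tendsto_const_nhds.congr' ?_
    filter_upwards [eventually_gt_atTop (len i)] with n hn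
    rw [if_neg (by omega)]
  · split_ifs <;> simp

end Shift

section Lifting

variable {ι K : Type*} [Fintype K] {e : Option (K × ι) ≃ ι} {len : ι → ℕ}
variable {H H' G : Type*} [NormedAddCommGroup H] [InnerProductSpace ℂ H]
  [NormedAddCommGroup H'] [InnerProductSpace ℂ H']
  [NormedAddCommGroup G] [InnerProductSpace ℂ G]

/-- One step of the iteration that solves for the system with transfer matrix `(U, V)`:
it makes the pair `(T, X)` satisfy the system one level deeper. -/
def transferStep (e : Option (K × ι) ≃ ι) (U : H × (K → G) →ₗ[ℂ] H') (V : H × (K → G) →ₗ[ℂ] G)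
    (Y : (lp (fun _ : ι => H) 2 →ₗ[ℂ] lp (fun _ : ι => H') 2) ×
      (lp (fun _ : ι => H) 2 →ₗ[ℂ] G)) :
    (lp (fun _ : ι => H) 2 →ₗ[ℂ] lp (fun _ : ι => H') 2) × (lp (fun _ : ι => H) 2 →ₗ[ℂ] G) :=
  let z : lp (fun _ : ι => H) 2 →ₗ[ℂ] H × (K → G) :=
    (lp.evalₗ (fun _ : ι => H) 2 (e none)).prod (LinearMap.pi fun k => Y.2 ∘ₗ backShift e k)
  (consShift e ∘ₗ (U ∘ₗ z).prod (LinearMap.pi fun k => Y.1 ∘ₗ backShift e k), V ∘ₗ z)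

variable {U : H × (K → G) →ₗ[ℂ] H'} {V : H × (K → G) →ₗ[ℂ] G}
  (Y Y' : (lp (fun _ : ι => H) 2 →ₗ[ℂ] lp (fun _ : ι => H') 2) × (lp (fun _ : ι => H) 2 →ₗ[ℂ] G))
  (x : lp (fun _ : ι => H) 2)

theorem transferStep_none :
    (transferStep e U V Y).1 x (e none) = U (x (e none), fun k => Y.2 (backShift e k x)) := by
  simp [transferStep]; rfl

theorem backShift_transferStep (k : K) :
    backShift e k ((transferStep e U V Y).1 x) = Y.1 (backShift e k x) := by
  simp [transferStep]

theorem transferStep_snd :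
    (transferStep e U V Y).2 x = V (x (e none), fun k => Y.2 (backShift e k x)) := rfl

theorem transferStep_contractive
    (hUV : ∀ z, ‖U z‖ ^ 2 + ‖V z‖ ^ 2 ≤ ‖z.1‖ ^ 2 + ∑ k, ‖z.2 k‖ ^ 2)
    (hY : ∀ x, ‖Y.1 x‖ ^ 2 + ‖Y.2 x‖ ^ 2 ≤ ‖x‖ ^ 2) :
    ‖(transferStep e U V Y).1 x‖ ^ 2 + ‖(transferStep e U V Y).2 x‖ ^ 2 ≤ ‖x‖ ^ 2 := by
  rw [norm_sq_eq_backShift e ((transferStep e U V Y).1 x), norm_sq_eq_backShift e x,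
    transferStep_none, transferStep_snd]
  simp only [backShift_transferStep]
  have h1 := hUV (x (e none), fun k => Y.2 (backShift e k x))
  have h2 := Finset.sum_le_sum fun k (_ : k ∈ Finset.univ) => hY (backShift e k x)
  rw [Finset.sum_add_distrib] at h2
  linarith

theorem transferStep_sub_le
    (hUV : ∀ z, ‖U z‖ ^ 2 + ‖V z‖ ^ 2 ≤ ‖z.1‖ ^ 2 + ∑ k, ‖z.2 k‖ ^ 2) :
    ‖(transferStep e U V Y).1 x - (transferStep e U V Y').1 x‖ ^ 2 +
      ‖(transferStep e U V Y).2 x - (transferStep e U V Y').2 x‖ ^ 2 ≤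
    ∑ k, (‖Y.1 (backShift e k x) - Y'.1 (backShift e k x)‖ ^ 2 +
      ‖Y.2 (backShift e k x) - Y'.2 (backShift e k x)‖ ^ 2) := by
  rw [norm_sq_eq_backShift e (_ - _), lp.coeFn_sub, Pi.sub_apply, transferStep_none,
    transferStep_none, transferStep_snd, transferStep_snd, ← map_sub, ← map_sub]
  simp only [map_sub, backShift_transferStep]
  have h1 := hUV ((x (e none), fun k => Y.2 (backShift e k x)) -
    (x (e none), fun k => Y'.2 (backShift e k x)))
  simp only [map_sub] at h1
  rw [Finset.sum_add_distrib]
  simp at h1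
  linarith

theorem iterate_transferStep_sub_le {c : ℝ}
    (hUV : ∀ z, ‖U z‖ ^ 2 + ‖V z‖ ^ 2 ≤ ‖z.1‖ ^ 2 + ∑ k, ‖z.2 k‖ ^ 2)
    (hY : ∀ x, ‖Y.1 x - Y'.1 x‖ ^ 2 + ‖Y.2 x - Y'.2 x‖ ^ 2 ≤ c * ‖x‖ ^ 2) (n : ℕ) :
    ‖((transferStep e U V)^[n] Y).1 x - ((transferStep e U V)^[n] Y').1 x‖ ^ 2 +
      ‖((transferStep e U V)^[n] Y).2 x - ((transferStep e U V)^[n] Y').2 x‖ ^ 2 ≤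
    c * tailSq e n x := by
  induction n generalizing x with
  | zero => exact hY x
  | succ n ih =>
    rw [Function.iterate_succ_apply', Function.iterate_succ_apply', tailSq, Finset.mul_sum]
    exact (transferStep_sub_le _ _ x hUV).trans (Finset.sum_le_sum fun k _ => ih _)

/-- **Commutant lifting.** A contractive linear relation `Γ` between square-summable sequence
spaces that is invariant under the backward shifts extends to an everywhere defined contraction
that commutes with the backward shifts. -/
theorem exists_lift [CompleteSpace H] [CompleteSpace H'] (hlen₀ : len (e none) = 0)
    (hlen : ∀ k i, len (e (some (k, i))) = len i + 1)
    (Γ : Submodule ℂ (lp (fun _ : ι => H) 2 × lp (fun _ : ι => H') 2))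
    (hΓ : ∀ z ∈ Γ, ‖z.2‖ ≤ ‖z.1‖)
    (hinv : ∀ z ∈ Γ, ∀ k, (backShift e k z.1, backShift e k z.2) ∈ Γ) :
    ∃ T : lp (fun _ : ι => H) 2 →L[ℂ] lp (fun _ : ι => H') 2, (∀ x, ‖T x‖ ≤ ‖x‖) ∧
      (∀ z ∈ Γ, T z.1 = z.2) ∧ ∀ k x, T (backShift e k x) = backShift e k (T x) := by
  obtain ⟨T₀, hT₀, hT₀Γ⟩ := exists_contraction_of_norm_le
    (LinearMap.fst ℂ _ _ ∘ₗ Γ.subtype) (LinearMap.snd ℂ _ _ ∘ₗ Γ.subtype) fun z => hΓ z z.2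
  obtain ⟨D, hD⟩ := exists_defect T₀ hT₀
  have hDΓ : ∀ z ∈ Γ, ‖z.2‖ ^ 2 + ‖D z.1‖ ^ 2 = ‖z.1‖ ^ 2 := fun z hz => by
    rw [← hD z.1, show T₀ z.1 = z.2 from hT₀Γ ⟨z, hz⟩]
  obtain ⟨U, V, hUV, hUVΓ⟩ := exists_contraction_of_sum_sq_le (K := K)
    (lp.evalₗ (fun _ : ι => H) 2 (e none) ∘ₗ LinearMap.fst ℂ _ _ ∘ₗ Γ.subtype)
    (fun k => D.toLinearMap ∘ₗ backShift e k ∘ₗ LinearMap.fst ℂ _ _ ∘ₗ Γ.subtype)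
    (lp.evalₗ (fun _ : ι => H') 2 (e none) ∘ₗ LinearMap.snd ℂ _ _ ∘ₗ Γ.subtype)
    (D.toLinearMap ∘ₗ LinearMap.fst ℂ _ _ ∘ₗ Γ.subtype) fun z => by
      have h1 := hDΓ z z.2
      have h2 := fun k => hDΓ _ (hinv z z.2 k)
      have h3 := Finset.sum_congr rfl fun k (_ : k ∈ Finset.univ) => h2 k
      rw [Finset.sum_add_distrib] at h3
      rw [norm_sq_eq_backShift e z.1.1, norm_sq_eq_backShift e z.1.2] at h1
      simp
      linarith
  let Y : ℕ → (lp (fun _ : ι => H) 2 →ₗ[ℂ] lp (fun _ : ι => H') 2) ×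
      (lp (fun _ : ι => H) 2 →ₗ[ℂ] lp (fun _ : ι => H) 2) :=
    fun n => (transferStep e U V)^[n] (T₀.toLinearMap, D.toLinearMap)
  have hY : ∀ n x, ‖(Y n).1 x‖ ^ 2 + ‖(Y n).2 x‖ ^ 2 ≤ ‖x‖ ^ 2 := by
    intro n
    induction n with
    | zero => exact fun x => (hD x).le
    | succ n ih =>
      intro x
      simp only [Y, Function.iterate_succ_apply']
      exact transferStep_contractive _ x hUV ih
  have hYΓ : ∀ n, ∀ z ∈ Γ, (Y n).1 z.1 = z.2 ∧ (Y n).2 z.1 = D z.1 := by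
    intro n
    induction n with
    | zero => exact fun z hz => ⟨hT₀Γ ⟨z, hz⟩, rfl⟩
    | succ n ih =>
      intro z hz
      simp only [Y, Function.iterate_succ_apply']
      have h1 : (fun k => (Y n).2 (backShift e k z.1)) = fun k => D (backShift e k z.1) :=
        funext fun k => (ih _ (hinv z hz k)).2
      refine ⟨ext_backShift e ?_ fun k => ?_, ?_⟩
      · rw [transferStep_none]
        exact (congrArg (fun f => U (z.1 (e none), f)) h1).trans (hUVΓ ⟨z, hz⟩).1
      · rw [backShift_transferStep]
        exact (ih _ (hinv z hz k)).1
      · rw [transferStep_snd]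
        exact (congrArg (fun f => V (z.1 (e none), f)) h1).trans (hUVΓ ⟨z, hz⟩).2
  have hdist : ∀ x n m, n ≤ m → dist ((Y n).1 x) ((Y m).1 x) ≤ √(4 * tailSq e n x) := by
    intro x n m hnm
    obtain ⟨j, rfl⟩ := Nat.exists_eq_add_of_le hnm
    refine Real.le_sqrt_of_sq_le ?_
    have h1 : ∀ x, ‖(Y 0).1 x - (Y j).1 x‖ ^ 2 + ‖(Y 0).2 x - (Y j).2 x‖ ^ 2 ≤ 4 * ‖x‖ ^ 2 := by
      intro x
      have h2 := hY 0 x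
      have h3 := hY j x
      have h4 := pow_le_pow_left₀ (norm_nonneg _) (norm_sub_le ((Y 0).1 x) ((Y j).1 x)) 2
      have h5 := pow_le_pow_left₀ (norm_nonneg _) (norm_sub_le ((Y 0).2 x) ((Y j).2 x)) 2
      nlinarith [sq_nonneg (‖(Y 0).1 x‖ - ‖(Y j).1 x‖), sq_nonneg (‖(Y 0).2 x‖ - ‖(Y j).2 x‖)]
    have h2 := iterate_transferStep_sub_le (e := e) (Y 0) (Y j) x hUV h1 n
    have h3 : (transferStep e U V)^[n] (Y j) = Y (n + j) :=
      (Function.iterate_add_apply _ _ _ _).symm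
    rw [h3] at h2
    rw [dist_eq_norm]
    exact (le_add_of_nonneg_right (sq_nonneg _)).trans h2
  have hlim : ∀ x, ∃ y, Tendsto (fun n => (Y n).1 x) atTop (𝓝 y) := fun x =>
    cauchySeq_tendsto_of_complete (cauchySeq_of_le_tendsto_0' _ (hdist x) (by
      simpa using ((tendsto_tailSq hlen₀ hlen x).const_mul 4).sqrt))
  choose T hT using hlim
  let T₁ : lp (fun _ : ι => H) 2 →ₗ[ℂ] lp (fun _ : ι => H') 2 :=
    linearMapOfTendsto T (fun n => (Y n).1) (tendsto_pi_nhds.2 hT)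
  have hbound : ∀ x, ‖T₁ x‖ ≤ ‖x‖ := fun x =>
    le_of_tendsto (hT x).norm (.of_forall fun n => le_of_sq_le_sq
      ((le_add_of_nonneg_right (sq_nonneg _)).trans (hY n x)) (norm_nonneg _))
  refine ⟨T₁.mkContinuous 1 (by simpa using hbound), hbound, fun z hz => ?_, fun k x => ?_⟩
  · refine tendsto_nhds_unique (hT z.1) (tendsto_const_nhds.congr fun n => ?_)
    exact (hYΓ n z hz).1.symm
  · ext i
    have hc : ∀ (j : ι) (u : ℕ → lp (fun _ : ι => H') 2) (y), Tendsto u atTop (𝓝 y) →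
        Tendsto (fun n => u n j) atTop (𝓝 (y j)) := fun j u y h =>
      ((lp.evalCLM ℂ (fun _ : ι => H') 2 j).continuous.tendsto y).comp h
    refine tendsto_nhds_unique (hc i _ _ (hT (backShift e k x)))
      (((hc _ _ _ (hT x)).comp (tendsto_add_atTop_nat 1)).congr fun n => ?_)
    simp only [Function.comp_apply, Y, Function.iterate_succ_apply']
    rw [← backShift_transferStep (U := U) (V := V), backShift_apply]

end Lifting

section Words

variable {d : ℕ}

/-- The decomposition of the free monoid into the unit and the words `k α`. -/
def leftSplit (d : ℕ) : Option (Fin d × FreeMonoid (Fin d)) ≃ FreeMonoid (Fin d) where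
  toFun o := o.elim 1 fun p => FreeMonoid.of p.1 * p.2
  invFun α := FreeMonoid.casesOn (motive := fun _ => Option (Fin d × FreeMonoid (Fin d))) α none
    fun k β => some (k, β)
  left_inv o := by rcases o with _ | ⟨k, β⟩ <;> rfl
  right_inv α := by cases α using FreeMonoid.casesOn <;> rfl

/-- The decomposition of the free monoid into the unit and the words `α k`. -/
def rightSplit (d : ℕ) : Option (Fin d × FreeMonoid (Fin d)) ≃ FreeMonoid (Fin d) where
  toFun o := o.elim 1 fun p => p.2 * FreeMonoid.of p.1
  invFun α := ((leftSplit d).symm α.reverse).map fun p => (p.1, p.2.reverse)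
  left_inv o := by
    rcases o with _ | ⟨k, β⟩
    · rfl
    · have : (β * FreeMonoid.of k).reverse = leftSplit d (some (k, β.reverse)) := by
        rw [FreeMonoid.reverse_mul]; rfl
      simp [this, FreeMonoid.reverse_reverse]
  right_inv α := by
    obtain ⟨o, ho⟩ := (leftSplit d).surjective α.reverse
    rw [← FreeMonoid.reverse_reverse (a := α), ← ho]
    rcases o with _ | ⟨k, β⟩
    · rfl
    · simp only [FreeMonoid.reverse_reverse, Equiv.symm_apply_apply]
      simp [leftSplit, FreeMonoid.reverse_mul]

@[simp] theorem leftSplit_none : leftSplit d none = 1 := rfl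
@[simp] theorem leftSplit_some (k : Fin d) (α : FreeMonoid (Fin d)) :
    leftSplit d (some (k, α)) = FreeMonoid.of k * α := rfl
@[simp] theorem rightSplit_none : rightSplit d none = 1 := rfl
@[simp] theorem rightSplit_some (k : Fin d) (α : FreeMonoid (Fin d)) :
    rightSplit d (some (k, α)) = α * FreeMonoid.of k := rfl

variable {n : ℕ} (Z : Ball d n)

@[simp] theorem Ball.word_one : Z.word 1 = 1 := map_one _
@[simp] theorem Ball.word_mul (α β : FreeMonoid (Fin d)) :
    Z.word (α * β) = Z.word α * Z.word β := map_mul _ _ _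
@[simp] theorem Ball.word_of (k : Fin d) : Z.word (FreeMonoid.of k) = Z.1 k :=
  FreeMonoid.lift_eval_of _ _

theorem Ball.word_intertwine {m : ℕ} {Z : Ball d n} {W : Ball d m}
    {X : Matrix (Fin n) (Fin m) ℂ} (h : ∀ k, Z.1 k * X = X * W.1 k) (α : FreeMonoid (Fin d)) :
    Z.word α * X = X * W.word α := by
  induction α using FreeMonoid.inductionOn' with
  | one => simp
  | of_mul k α ih =>
    simp only [Ball.word_mul, Ball.word_of, Matrix.mul_assoc, ih]
    rw [← Matrix.mul_assoc, h, Matrix.mul_assoc]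

open scoped Matrix.Norms.L2Operator in
theorem Ball.sum_norm_vecMul_sq_le (u : Fin n → ℂ) :
    ∑ k, ∑ j, ‖(u ᵥ* Z.1 k) j‖ ^ 2 ≤ ‖rowMatrix Z.1‖ ^ 2 * ∑ j, ‖u j‖ ^ 2 := by
  have h := Matrix.l2_opNorm_mulVec (rowMatrix Z.1)ᴴ (WithLp.toLp 2 (star u))
  rw [Matrix.l2_opNorm_conjTranspose] at h
  have h2 := pow_le_pow_left₀ (norm_nonneg _) h 2
  rw [mul_pow, EuclideanSpace.norm_sq_eq, EuclideanSpace.norm_sq_eq] at h2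
  simp only [Fintype.sum_prod_type] at h2
  have e1 : ∀ k j, ‖((rowMatrix Z.1)ᴴ *ᵥ star u) (k, j)‖ = ‖(u ᵥ* Z.1 k) j‖ := fun k j => by
    rw [← Matrix.star_vecMul, Pi.star_apply, norm_star]
    simp [Matrix.vecMul, dotProduct, rowMatrix]
  have e2 : ∀ j, ‖star u j‖ = ‖u j‖ := fun j => norm_star (u j)
  simp only [← e1, ← e2]
  exact h2

open scoped Matrix.Norms.L2Operator in
theorem Ball.summable_norm_vecMul_word_sq (u : Fin n → ℂ) :
    Summable fun α : FreeMonoid (Fin d) => ∑ j, ‖(u ᵥ* Z.word α) j‖ ^ 2 := by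
  set r := ‖rowMatrix Z.1‖ with hr
  have hr0 : 0 ≤ r := norm_nonneg _
  have hr1 : r < 1 := Z.2
  have hr2 : 0 < 1 - r ^ 2 := by nlinarith
  let q : (Fin n → ℂ) → ℝ := fun u => ∑ j, ‖u j‖ ^ 2
  have hq0 : ∀ u, 0 ≤ q u := fun u => by positivity
  have key : ∀ N : ℕ, ∀ u, ∑' α : FreeMonoid (Fin d),
      (if α.length < N then ENNReal.ofReal (q (u ᵥ* Z.word α)) else 0)
        ≤ ENNReal.ofReal ((1 - r ^ 2)⁻¹ * q u) := by
    intro N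
    induction N with
    | zero => simp
    | succ N ih =>
      intro u
      have h1 := (hasSum_of_shift (leftSplit d) (fun α : FreeMonoid (Fin d) =>
        (if α.length < N + 1 then ENNReal.ofReal (q (u ᵥ* Z.word α)) else 0))
        fun k => ENNReal.summable.hasSum).tsum_eq
      rw [h1]
      simp only [leftSplit_none, leftSplit_some, FreeMonoid.length_mul, FreeMonoid.length_of,
        FreeMonoid.length_one, Ball.word_mul, Ball.word_of, Ball.word_one, Matrix.vecMul_one,
        ← Matrix.vecMul_vecMul, add_comm 1, add_lt_add_iff_right, Nat.succ_pos, if_true]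
      calc _ ≤ ENNReal.ofReal (q u) + ∑ k, ENNReal.ofReal ((1 - r ^ 2)⁻¹ * q (u ᵥ* Z.1 k)) := by
            gcongr with k
            exact ih _
        _ = ENNReal.ofReal (q u + ∑ k, (1 - r ^ 2)⁻¹ * q (u ᵥ* Z.1 k)) := by
            rw [ENNReal.ofReal_add (hq0 _) (Finset.sum_nonneg fun k _ =>
              mul_nonneg (inv_nonneg.2 hr2.le) (hq0 _)), ENNReal.ofReal_sum_of_nonneg fun k _ =>
              mul_nonneg (inv_nonneg.2 hr2.le) (hq0 _)]
        _ ≤ _ := by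
            refine ENNReal.ofReal_le_ofReal ?_
            rw [← Finset.mul_sum]
            have h2 : ∑ k, q (u ᵥ* Z.1 k) ≤ r ^ 2 * q u := Z.sum_norm_vecMul_sq_le u
            calc _ ≤ q u + (1 - r ^ 2)⁻¹ * (r ^ 2 * q u) := by gcongr
              _ = _ := by field_simp; ring
  refine summable_of_sum_le (c := (1 - r ^ 2)⁻¹ * q u) (fun α => hq0 _) fun s => ?_
  rw [← ENNReal.ofReal_le_ofReal_iff (mul_nonneg (inv_nonneg.2 hr2.le) (hq0 _)),
    ENNReal.ofReal_sum_of_nonneg fun α _ => hq0 _]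
  refine le_trans ?_ (key (s.sup FreeMonoid.length + 1) u)
  refine le_trans (Finset.sum_le_sum fun α hα => ?_) (ENNReal.sum_le_tsum s)
  rw [if_pos (Nat.lt_succ_of_le (Finset.le_sup (f := FreeMonoid.length) hα))]

theorem Ball.summable_norm_word_sq (i j : Fin n) :
    Summable fun α : FreeMonoid (Fin d) => ‖Z.word α i j‖ ^ 2 := by
  refine (Z.summable_norm_vecMul_word_sq (Pi.single i 1)).of_nonneg_of_le
    (fun α => by positivity) fun α => ?_
  simp only [Matrix.single_one_vecMul]
  exact Finset.single_le_sum (f := fun j => ‖Z.word α i j‖ ^ 2) (fun _ _ => by positivity)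
    (Finset.mem_univ j)

end Words

section KernelVectors

variable {d n : ℕ} (Z : Ball d n) {H : Type*} [NormedAddCommGroup H] [InnerProductSpace ℂ H]

/-- The vectors of the Fock space that represent the entries of the point evaluation at `Z`. -/
def kernelVec (i j : Fin n) : H →L[ℂ] Fock d H :=
  LinearMap.mkContinuous
    { toFun := fun h => ⟨fun α => conj (Z.word α i j) • h, memℓp_two_iff_summable_sq.2 <| by
        simpa [norm_smul, mul_pow] using (Z.summable_norm_word_sq i j).mul_right (‖h‖ ^ 2)⟩
      map_add' := fun _ _ => by ext; exact smul_add _ _ _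
      map_smul' := fun _ _ => by ext; exact smul_comm _ _ _ }
    √(∑' α, ‖Z.word α i j‖ ^ 2) fun h => by
      refine le_of_sq_le_sq ?_ (by positivity)
      rw [mul_pow, Real.sq_sqrt (tsum_nonneg fun _ => by positivity), norm_sq_eq_tsum,
        ← tsum_mul_right]
      simp [norm_smul, mul_pow]

@[simp]
theorem kernelVec_apply (i j : Fin n) (h : H) (α : FreeMonoid (Fin d)) :
    kernelVec Z i j h α = conj (Z.word α i j) • h := rfl

theorem backShift_left_kernelVec (k : Fin d) (i j : Fin n) (h : H) :
    backShift (leftSplit d) k (kernelVec Z i j h)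
      = ∑ l, kernelVec Z l j (conj (Z.1 k i l) • h) := by
  ext α
  rw [lp.coeFn_sum, Finset.sum_apply]
  simp [Matrix.mul_apply, Finset.sum_smul, smul_smul, mul_comm]

theorem backShift_right_kernelVec (k : Fin d) (i j : Fin n) (h : H) :
    backShift (rightSplit d) k (kernelVec Z i j h)
      = ∑ l, kernelVec Z i l (conj (Z.1 k l j) • h) := by
  ext α
  rw [lp.coeFn_sum, Finset.sum_apply]
  simp [Matrix.mul_apply, Finset.sum_smul, smul_smul, mul_comm]

/-- The scalar Szegő kernel `∑_α Z^α_{ij} conj (Z^α_{kl})`. -/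
def gram (i j k l : Fin n) : ℂ := ∑' α : FreeMonoid (Fin d), Z.word α i j * conj (Z.word α k l)

theorem summable_gram (i j k l : Fin n) :
    Summable fun α : FreeMonoid (Fin d) => Z.word α i j * conj (Z.word α k l) := by
  have h := lp.summable_inner (𝕜 := ℂ) (kernelVec Z i j (1 : ℂ)) (kernelVec Z k l (1 : ℂ))
  refine h.congr fun α => ?_
  simp [mul_comm]

theorem inner_kernelVec (i j k l : Fin n) (h h' : H) :
    inner ℂ (kernelVec Z i j h) (kernelVec Z k l h') = gram Z i j k l * inner ℂ h h' := by
  rw [lp.inner_eq_tsum, gram, ← tsum_mul_right]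
  congr 1 with α
  simp [inner_smul_left, inner_smul_right]
  ring

theorem szego_apply {V : Type*} [NormedAddCommGroup V] [NormedSpace ℂ V]
    (Q : Matrix (Fin n) (Fin n) V) (i j : Fin n) :
    szego Z Z Q i j = ∑ k, ∑ l, gram Z i k j l • Q k l := by
  have h : HasSum (fun α => mulScalar (scalarMul (Z.word α) Q) (Z.word α)ᴴ)
      (Matrix.of fun i j => ∑ k, ∑ l, gram Z i k j l • Q k l) := by
    refine Pi.hasSum.2 fun i => Pi.hasSum.2 fun j => ?_
    rw [Matrix.of_apply]
    have h1 : HasSum (fun α => ∑ k, ∑ l, (Z.word α i k * conj (Z.word α j l)) • Q k l)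
        (∑ k, ∑ l, gram Z i k j l • Q k l) :=
      hasSum_sum fun k _ => hasSum_sum fun l _ => (summable_gram Z i k j l).hasSum.smul_const _
    convert h1 using 1
    funext α
    simp only [mulScalar, scalarMul, Matrix.of_apply, Finset.smul_sum, smul_smul,
      Matrix.conjTranspose_apply]
    rw [Finset.sum_comm]
    simp only [mul_comm]; rfl
  rw [szego, h.tsum_eq, Matrix.of_apply]

variable [CompleteSpace H]

theorem hasSum_adjoint_kernelVec (i j : Fin n) (x : Fock d H) :
    HasSum (fun α => Z.word α i j • x α) (ContinuousLinearMap.adjoint (kernelVec Z i j) x) := by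
  classical
  have h := (lp.hasSum_single (by norm_num) x).mapL (ContinuousLinearMap.adjoint (kernelVec Z i j))
  convert h using 1
  funext α
  refine ext_inner_left ℂ fun v => ?_
  rw [ContinuousLinearMap.adjoint_inner_right, lp.inner_single_right, kernelVec_apply,
    inner_smul_left, inner_smul_right, RCLike.conj_conj]

theorem Fock.eval_apply (x : Fock d H) (i j : Fin n) :
    x.eval n Z i j = ContinuousLinearMap.adjoint (kernelVec Z i j) x := by
  have h : HasSum (fun α => (Matrix.of fun i j => Z.word α i j • x α : Matrix (Fin n) (Fin n) H))
      (Matrix.of fun i j => ContinuousLinearMap.adjoint (kernelVec Z i j) x) :=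
    Pi.hasSum.2 fun i => Pi.hasSum.2 fun j => hasSum_adjoint_kernelVec Z i j x
  rw [Fock.eval, h.tsum_eq, Matrix.of_apply]

end KernelVectors

section DirectSum

variable {d n m : ℕ}

open scoped Matrix.Norms.L2Operator in
theorem norm_rowMatrix_le {Z : Fin d → Matrix (Fin n) (Fin n) ℂ} {c : ℝ} (hc : 0 ≤ c)
    (h : ∀ u : Fin n → ℂ, ∑ k, ∑ j, ‖(u ᵥ* Z k) j‖ ^ 2 ≤ c ^ 2 * ∑ j, ‖u j‖ ^ 2) :
    ‖rowMatrix Z‖ ≤ c := by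
  rw [← Matrix.l2_opNorm_conjTranspose, Matrix.l2_opNorm_def]
  refine ContinuousLinearMap.opNorm_le_bound _ hc fun u => ?_
  refine le_of_sq_le_sq ?_ (by positivity)
  rw [mul_pow, EuclideanSpace.norm_sq_eq, EuclideanSpace.norm_sq_eq]
  simp only [Fintype.sum_prod_type]
  have e1 : ∀ k j, ‖((rowMatrix Z)ᴴ *ᵥ u.ofLp) (k, j)‖ = ‖(star u.ofLp ᵥ* Z k) j‖ :=
    fun k j => by
      rw [← star_star u.ofLp, ← Matrix.star_vecMul, Pi.star_apply, norm_star]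
      simp [Matrix.vecMul, dotProduct, rowMatrix]
  have e2 : ∀ j, ‖star u.ofLp j‖ = ‖u.ofLp j‖ := fun j => norm_star (u.ofLp j)
  have h1 := h (star u.ofLp)
  simp only [← e1, e2] at h1
  exact h1

open scoped Matrix.Norms.L2Operator in
/-- The unique point of level zero. -/
def Ball.empty : Ball d 0 :=
  ⟨0, by rw [show rowMatrix (0 : Fin d → Matrix (Fin 0) (Fin 0) ℂ) = 0 from
    Subsingleton.elim _ _, norm_zero]; exact one_pos⟩

/-- The direct sum of two points of the noncommutative ball. -/
def Ball.directSum (Z : Ball d n) (W : Ball d m) : Ball d (n + m) :=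
  ⟨fun k => Matrix.reindex finSumFinEquiv finSumFinEquiv (Matrix.fromBlocks (Z.1 k) 0 0 (W.1 k)), by
    open scoped Matrix.Norms.L2Operator in
    refine lt_of_le_of_lt (norm_rowMatrix_le (c := max ‖rowMatrix Z.1‖ ‖rowMatrix W.1‖)
      (by positivity) fun u => ?_) (max_lt Z.2 W.2)
    have h1 := Z.sum_norm_vecMul_sq_le fun i => u (Fin.castAdd m i)
    have h2 := W.sum_norm_vecMul_sq_le fun i => u (Fin.natAdd n i)
    simp only [Fin.sum_univ_add, Finset.sum_add_distrib, mul_add]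
    refine add_le_add ?_ ?_
    · refine (le_of_eq ?_).trans (h1.trans ?_)
      · simp [Matrix.vecMul, dotProduct, Fin.sum_univ_add]
      · gcongr; exact le_max_left _ _
    · refine (le_of_eq ?_).trans (h2.trans ?_)
      · simp [Matrix.vecMul, dotProduct, Fin.sum_univ_add]
      · gcongr; exact le_max_right _ _⟩

variable {V : Type*} [AddCommGroup V] [Module ℂ V] {f : GradedFun d V}

theorem IsFree.directSum_castAdd (hf : IsFree f) (Z : Ball d n) (W : Ball d m)
    (a : Fin (n + m)) (j : Fin n) :
    f (n + m) (Z.directSum W) a (Fin.castAdd m j) = Fin.addCases (fun i => f n Z i j) 0 a := by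
  have h := congrFun (congrFun (hf _ _ (Z.directSum W) Z
    (Matrix.of fun a i => if a = Fin.castAdd m i then 1 else 0) fun k => ?_) a) j
  · simp only [mulScalar, scalarMul, Matrix.of_apply, ite_smul, one_smul, zero_smul,
      Finset.sum_ite_eq', Finset.mem_univ, if_true] at h
    rw [h]
    refine Fin.addCases (fun i => ?_) (fun i => ?_) a
    · simp
    · rw [Fin.addCases_right]
      exact Finset.sum_eq_zero fun x _ => if_neg (by simp [Fin.ext_iff]; omega)
  · ext a j
    refine Fin.addCases (fun i => ?_) (fun i => ?_) a <;>
      simp [Matrix.mul_apply, Ball.directSum]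
    exact (Finset.sum_eq_zero fun x _ => if_neg (by simp [Fin.ext_iff]; omega)).symm

theorem IsFree.directSum_natAdd (hf : IsFree f) (Z : Ball d n) (W : Ball d m)
    (a : Fin (n + m)) (j : Fin m) :
    f (n + m) (Z.directSum W) a (Fin.natAdd n j) = Fin.addCases 0 (fun i => f m W i j) a := by
  have h := congrFun (congrFun (hf _ _ (Z.directSum W) W
    (Matrix.of fun a i => if a = Fin.natAdd n i then 1 else 0) fun k => ?_) a) j
  · simp only [mulScalar, scalarMul, Matrix.of_apply, ite_smul, one_smul, zero_smul,
      Finset.sum_ite_eq', Finset.mem_univ, if_true] at h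
    rw [h]
    refine Fin.addCases (fun i => ?_) (fun i => ?_) a
    · rw [Fin.addCases_left]
      exact Finset.sum_eq_zero fun x _ => if_neg (by simp [Fin.ext_iff]; omega)
    · simp
  · ext a j
    refine Fin.addCases (fun i => ?_) (fun i => ?_) a <;>
      simp [Matrix.mul_apply, Ball.directSum]
    exact (Finset.sum_eq_zero fun x _ => if_neg (by simp [Fin.ext_iff]; omega)).symm

theorem isFree_word (α : FreeMonoid (Fin d)) : IsFree fun n (Z : Ball d n) => Z.word α := by
  intro n m Z W X h
  have := Ball.word_intertwine h α
  ext i j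
  simpa [mulScalar, scalarMul, Matrix.mul_apply, mul_comm] using congrFun (congrFun this i) j

end DirectSum

section CoefficientFamilies

variable {d : ℕ} {H J : Type*} [NormedAddCommGroup H] [InnerProductSpace ℂ H]
  [NormedAddCommGroup J] [InnerProductSpace ℂ J]

/-- The combination `∑ k_{Z,i,j} w_{ij}` of kernel vectors at a point. -/
def kernelComb {n : ℕ} (Z : Ball d n) (w : Matrix (Fin n) (Fin n) H) : Fock d H :=
  ∑ i, ∑ j, kernelVec Z i j (w i j)

theorem kernelComb_apply {n : ℕ} (Z : Ball d n) (w : Matrix (Fin n) (Fin n) H)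
    (α : FreeMonoid (Fin d)) :
    kernelComb Z w α = ∑ i, ∑ j, conj (Z.word α i j) • w i j := by
  rw [kernelComb, lp.coeFn_sum, Finset.sum_apply]
  refine Finset.sum_congr rfl fun i _ => ?_
  rw [lp.coeFn_sum, Finset.sum_apply]
  rfl

theorem kernelComb_smul {n : ℕ} (Z : Ball d n) (c : ℂ) (w : Matrix (Fin n) (Fin n) H) :
    kernelComb Z (c • w) = c • kernelComb Z w := by
  simp [kernelComb, Finset.smul_sum]

theorem kernelComb_directSum {n m : ℕ} (Z : Ball d n) (W : Ball d m)
    (w : Matrix (Fin (n + m)) (Fin (n + m)) H) :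
    kernelComb (Z.directSum W) w = kernelComb Z (w.submatrix (Fin.castAdd m) (Fin.castAdd m)) +
      kernelComb W (w.submatrix (Fin.natAdd n) (Fin.natAdd n)) := by
  refine Subtype.ext (funext fun α => ?_)
  have h1 := (isFree_word α).directSum_castAdd Z W
  have h2 := (isFree_word α).directSum_natAdd Z W
  change kernelComb (Z.directSum W) w α =
    kernelComb Z (w.submatrix (Fin.castAdd m) (Fin.castAdd m)) α +
      kernelComb W (w.submatrix (Fin.natAdd n) (Fin.natAdd n)) α
  simp [kernelComb_apply, Fin.sum_univ_add, h1, h2, Finset.sum_add_distrib]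

theorem inner_kernelComb {n : ℕ} (Z : Ball d n) (w : Matrix (Fin n) (Fin n) H) :
    inner ℂ (kernelComb Z w) (kernelComb Z w) =
      ∑ a, ∑ b, ∑ i, ∑ j, gram Z a b i j * inner ℂ (w a b) (w i j) := by
  simp only [kernelComb, sum_inner]
  simp only [inner_sum, inner_kernelVec]

/-- A family of matrix coefficients depending on a point and two vectors that is homogeneous in the
last one and compatible with direct sums. -/
structure IsDirectSumFamily
    (w : ∀ n, Ball d n → (Fin n → ℂ) → (Fin n → J) → Matrix (Fin n) (Fin n) H) : Prop where
  smul : ∀ n Z v (c : ℂ) y, w n Z v (c • y) = c • w n Z v y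
  castAdd : ∀ n m (Z : Ball d n) (W : Ball d m) v v' y y',
    (w (n + m) (Z.directSum W) (Fin.append v v') (Fin.append y y')).submatrix
      (Fin.castAdd m) (Fin.castAdd m) = w n Z v y
  natAdd : ∀ n m (Z : Ball d n) (W : Ball d m) v v' y y',
    (w (n + m) (Z.directSum W) (Fin.append v v') (Fin.append y y')).submatrix
      (Fin.natAdd n) (Fin.natAdd n) = w m W v' y'

variable {H' : Type*} [NormedAddCommGroup H'] [InnerProductSpace ℂ H']
  {w : ∀ n, Ball d n → (Fin n → ℂ) → (Fin n → J) → Matrix (Fin n) (Fin n) H}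
  {w' : ∀ n, Ball d n → (Fin n → ℂ) → (Fin n → J) → Matrix (Fin n) (Fin n) H'}

/-- The linear relation consisting of the pairs of kernel combinations of two families. -/
def kernelRelation (hw : IsDirectSumFamily w) (hw' : IsDirectSumFamily w') :
    Submodule ℂ (Fock d H × Fock d H') where
  carrier := {z | ∃ n Z v y, z = (kernelComb Z (w n Z v y), kernelComb Z (w' n Z v y))}
  zero_mem' := ⟨0, Ball.empty, 0, 0, by simp [kernelComb, Prod.ext_iff]⟩
  add_mem' := by
    rintro _ _ ⟨n, Z, v, y, rfl⟩ ⟨m, W, v', y', rfl⟩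
    refine ⟨n + m, Z.directSum W, Fin.append v v', Fin.append y y', ?_⟩
    rw [kernelComb_directSum, kernelComb_directSum, hw.castAdd, hw.natAdd, hw'.castAdd, hw'.natAdd]
    rfl
  smul_mem' := by
    rintro c _ ⟨n, Z, v, y, rfl⟩
    exact ⟨n, Z, v, c • y, by rw [hw.smul, hw'.smul, kernelComb_smul, kernelComb_smul]; rfl⟩

theorem exists_lift_kernelComb [CompleteSpace H] [CompleteSpace H']
    {e : Option (Fin d × FreeMonoid (Fin d)) ≃ FreeMonoid (Fin d)} (he₀ : (e none).length = 0)
    (he : ∀ k α, (e (some (k, α))).length = α.length + 1)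
    (hw : IsDirectSumFamily w) (hw' : IsDirectSumFamily w')
    (hnorm : ∀ n Z v y, ‖kernelComb Z (w' n Z v y)‖ ≤ ‖kernelComb Z (w n Z v y)‖)
    (hshift : ∀ n Z v y k, ∃ v' y',
      backShift e k (kernelComb Z (w n Z v y)) = kernelComb Z (w n Z v' y') ∧
      backShift e k (kernelComb Z (w' n Z v y)) = kernelComb Z (w' n Z v' y')) :
    ∃ T : Fock d H →L[ℂ] Fock d H', (∀ x, ‖T x‖ ≤ ‖x‖) ∧
      (∀ n Z v y, T (kernelComb Z (w n Z v y)) = kernelComb Z (w' n Z v y)) ∧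
      ∀ k x, T (backShift e k x) = backShift e k (T x) := by
  obtain ⟨T, hT, hTΓ, hTe⟩ := exists_lift he₀ he (kernelRelation hw hw')
    (by rintro _ ⟨n, Z, v, y, rfl⟩; exact hnorm n Z v y)
    (by
      rintro _ ⟨n, Z, v, y, rfl⟩ k
      obtain ⟨v', y', h1, h2⟩ := hshift n Z v y k
      exact ⟨n, Z, v', y', by rw [h1, h2]⟩)
  exact ⟨T, hT, fun n Z v y => hTΓ _ ⟨n, Z, v, y, rfl⟩, hTe⟩

theorem split_induction {ι K : Type*} {e : Option (K × ι) ≃ ι} {len : ι → ℕ}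
    (he : ∀ k i, len (e (some (k, i))) = len i + 1) {p : ι → Prop} (h₀ : p (e none))
    (h : ∀ k i, p i → p (e (some (k, i)))) (i : ι) : p i := by
  induction hl : len i using Nat.strong_induction_on generalizing i with
  | _ N ih =>
    obtain ⟨o, rfl⟩ := e.surjective i
    rcases o with _ | ⟨k, j⟩
    · exact h₀
    · exact h k j (ih (len j) (by rw [← hl, he]; omega) j rfl)

end CoefficientFamilies

open scoped ComplexOrder in
theorem norm_le_of_isCPNC {n d : ℕ} {H H' J : Type*} [NormedAddCommGroup H]
    [InnerProductSpace ℂ H] [NormedAddCommGroup H'] [InnerProductSpace ℂ H'] [NormedAddCommGroup J]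
    [InnerProductSpace ℂ J] {K K' : GradedKernel d J} (hK : IsCPNC (K - K'))
    (Z : Ball d n) (v : Fin n → ℂ) (y : Fin n → J) {w : H} {w' : H'}
    (hw : inner ℂ w w = ∑ i, ∑ j, inner ℂ (y i) (K n n Z Z (Matrix.vecMulVec v (star v)) i j (y j)))
    (hw' : inner ℂ w' w' =
      ∑ i, ∑ j, inner ℂ (y i) (K' n n Z Z (Matrix.vecMulVec v (star v)) i j (y j))) :
    ‖w'‖ ≤ ‖w‖ := by
  have h := hK.pos n Z _ (Matrix.posSemidef_vecMulVec_self_star v) y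
  have h1 : ∀ i j, (K - K') n n Z Z (Matrix.vecMulVec v (star v)) i j =
    K n n Z Z (Matrix.vecMulVec v (star v)) i j - K' n n Z Z (Matrix.vecMulVec v (star v)) i j :=
    fun _ _ => rfl
  simp only [h1, sub_apply, inner_sub_right, Finset.sum_sub_distrib, ← hw, ← hw',
    inner_self_eq_norm_sq_to_K, sub_nonneg] at h
  refine le_of_sq_le_sq ?_ (norm_nonneg _)
  exact_mod_cast h

section Coefficients

variable {d : ℕ} {H H' J : Type*}
  [NormedAddCommGroup H] [InnerProductSpace ℂ H] [CompleteSpace H]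
  [NormedAddCommGroup H'] [InnerProductSpace ℂ H'] [CompleteSpace H']
  [NormedAddCommGroup J] [InnerProductSpace ℂ J] [CompleteSpace J]

/-- The coefficients of the adjoint of left multiplication by `A` on kernel vectors. -/
def leftCoeff (A : GradedFun d (H →L[ℂ] J)) (n : ℕ) (Z : Ball d n) (v : Fin n → ℂ)
    (y : Fin n → J) : Matrix (Fin n) (Fin n) H :=
  Matrix.of fun i j => conj (v j) • ∑ l, ContinuousLinearMap.adjoint (A n Z l i) (y l)

/-- The coefficients of the adjoint of right multiplication by `A` on kernel vectors. -/
def rightCoeff (A : GradedFun d (H →L[ℂ] J)) (n : ℕ) (Z : Ball d n) (v : Fin n → ℂ)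
    (y : Fin n → J) : Matrix (Fin n) (Fin n) H :=
  Matrix.of fun i j => ∑ l, conj (v l) • ContinuousLinearMap.adjoint (A n Z j l) (y i)

theorem isDirectSumFamily_leftCoeff {A : GradedFun d (H →L[ℂ] J)} (hA : IsFree A) :
    IsDirectSumFamily (leftCoeff A) where
  smul n Z v c y := by
    ext i j
    simp [leftCoeff, Finset.smul_sum, smul_comm c]
  castAdd n m Z W v v' y y' := by
    ext i j
    simp [leftCoeff, Fin.sum_univ_add, hA.directSum_castAdd]
  natAdd n m Z W v v' y y' := by
    ext i j
    simp [leftCoeff, Fin.sum_univ_add, hA.directSum_natAdd]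

theorem isDirectSumFamily_rightCoeff {A : GradedFun d (H →L[ℂ] J)} (hA : IsFree A) :
    IsDirectSumFamily (rightCoeff A) where
  smul n Z v c y := by
    ext i j
    simp [rightCoeff, Finset.smul_sum, smul_comm c]
  castAdd n m Z W v v' y y' := by
    ext i j
    simp [rightCoeff, Fin.sum_univ_add, hA.directSum_castAdd, hA.directSum_natAdd]
  natAdd n m Z W v v' y y' := by
    ext i j
    simp [rightCoeff, Fin.sum_univ_add, hA.directSum_castAdd, hA.directSum_natAdd]

variable (A : GradedFun d (H →L[ℂ] J)) {n : ℕ} (Z : Ball d n) (v : Fin n → ℂ) (y : Fin n → J)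

theorem backShift_leftCoeff (k : Fin d) :
    backShift (rightSplit d) k (kernelComb Z (leftCoeff A n Z v y)) =
      kernelComb Z (leftCoeff A n Z (Z.1 k *ᵥ v) y) := by
  simp only [kernelComb, map_sum, backShift_right_kernelVec]
  refine Finset.sum_congr rfl fun i _ => ?_
  rw [Finset.sum_comm]
  refine Finset.sum_congr rfl fun l _ => ?_
  rw [← map_sum]
  congr 1
  simp [leftCoeff, Matrix.mulVec, dotProduct, Finset.sum_smul, smul_smul]

theorem backShift_rightCoeff (k : Fin d) :
    backShift (leftSplit d) k (kernelComb Z (rightCoeff A n Z v y)) =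
      kernelComb Z (rightCoeff A n Z v fun l => ∑ i, conj (Z.1 k i l) • y i) := by
  simp only [kernelComb, map_sum, backShift_left_kernelVec]
  rw [Finset.sum_comm]
  conv_rhs => rw [Finset.sum_comm]
  refine Finset.sum_congr rfl fun j _ => ?_
  rw [Finset.sum_comm]
  refine Finset.sum_congr rfl fun l _ => ?_
  rw [← map_sum]
  congr 1
  simp only [rightCoeff, Matrix.of_apply, map_sum, Finset.smul_sum]
  rw [Finset.sum_comm]
  simp only [map_smul, smul_smul, mul_comm]

theorem sum_comm_pairs {κ M : Type*} [Fintype κ] [AddCommMonoid M] (F : κ → κ → κ → κ → M) :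
    ∑ i, ∑ j, ∑ a, ∑ b, F i j a b = ∑ a, ∑ b, ∑ i, ∑ j, F i j a b := by
  have h1 := Finset.sum_comm (s := Finset.univ) (t := Finset.univ)
    (f := fun (p q : κ × κ) => F p.1 p.2 q.1 q.2)
  simpa only [Fintype.sum_prod_type] using h1

theorem inner_kernelComb_leftCoeff :
    inner ℂ (kernelComb Z (leftCoeff A n Z v y)) (kernelComb Z (leftCoeff A n Z v y)) =
      ∑ i, ∑ j, inner ℂ (y i) (leftKernel A n n Z Z (Matrix.vecMulVec v (star v)) i j (y j)) := by
  have h1 : ∀ i j, inner ℂ (y i)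
      (leftKernel A n n Z Z (Matrix.vecMulVec v (star v)) i j (y j)) =
      ∑ c, ∑ a, szego Z Z (Matrix.vecMulVec v (star v)) a c *
        inner ℂ (ContinuousLinearMap.adjoint (A n Z i a) (y i))
          (ContinuousLinearMap.adjoint (A n Z j c) (y j)) := by
    intro i j
    simp [leftKernel, opMul, mulScalar, opAdjoint, ContinuousLinearMap.adjoint_inner_left]
  simp only [h1]
  rw [sum_comm_pairs, inner_kernelComb, Finset.sum_comm]
  have h2 : ∀ a c, ∑ i, ∑ j, szego Z Z (Matrix.vecMulVec v (star v)) a c *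
        inner ℂ (ContinuousLinearMap.adjoint (A n Z i a) (y i))
          (ContinuousLinearMap.adjoint (A n Z j c) (y j)) =
      ∑ b, ∑ e, gram Z a b c e * inner ℂ (leftCoeff A n Z v y a b) (leftCoeff A n Z v y c e) := by
    intro a c
    simp only [← Finset.mul_sum, ← inner_sum, ← sum_inner]
    rw [szego_apply, Finset.sum_mul]
    refine Finset.sum_congr rfl fun b _ => ?_
    rw [Finset.sum_mul]
    refine Finset.sum_congr rfl fun e _ => ?_
    simp only [leftCoeff, Matrix.of_apply, inner_smul_left, inner_smul_right,
      Matrix.vecMulVec_apply, RCLike.conj_conj, Pi.star_apply, smul_eq_mul, RCLike.star_def]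
    ring
  rw [Finset.sum_comm]
  conv_rhs => rw [Finset.sum_comm]
  simp only [h2]
  exact Finset.sum_congr rfl fun a _ => Finset.sum_comm

theorem inner_kernelComb_rightCoeff :
    inner ℂ (kernelComb Z (rightCoeff A n Z v y)) (kernelComb Z (rightCoeff A n Z v y)) =
      ∑ i, ∑ j, inner ℂ (y i) (rightKernel A n n Z Z (Matrix.vecMulVec v (star v)) i j (y j)) := by
  rw [inner_kernelComb]
  refine Finset.sum_congr rfl fun i _ => ?_
  rw [Finset.sum_comm]
  refine Finset.sum_congr rfl fun j _ => ?_
  simp only [rightKernel, szego_apply, sum_apply, inner_sum]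
  refine Finset.sum_congr rfl fun k _ => Finset.sum_congr rfl fun l _ => ?_
  rw [smul_apply, inner_smul_right]
  congr 1
  simp only [rightCoeff, opMul, mulScalar, opAdjoint, Matrix.of_apply,
    sum_apply, inner_sum, sum_inner, ContinuousLinearMap.comp_apply,
    smul_apply, inner_smul_left, inner_smul_right,
    ContinuousLinearMap.adjoint_inner_left, Matrix.vecMulVec_apply, Finset.mul_sum,
    RCLike.conj_conj, Pi.star_apply, RCLike.star_def]
  refine Finset.sum_congr rfl fun a _ => Finset.sum_congr rfl fun b _ => ?_
  ring

/-- The multiplier whose adjoint entries are the vacuum components of `T` on kernel vectors. -/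
def symbol (T : Fock d H →L[ℂ] Fock d H') : GradedFun d (H' →L[ℂ] H) := fun _ Z =>
  Matrix.of fun i j => ContinuousLinearMap.adjoint
    ((lp.evalCLM ℂ (fun _ : FreeMonoid (Fin d) => H') 2 1).comp (T.comp (kernelVec Z i j)))

theorem adjoint_symbol_apply (T : Fock d H →L[ℂ] Fock d H') (i j : Fin n) (h : H) :
    ContinuousLinearMap.adjoint (symbol T n Z i j) h = T (kernelVec Z i j h) 1 := by
  rw [symbol, Matrix.of_apply, ContinuousLinearMap.adjoint_adjoint]
  rfl

theorem isFree_symbol (T : Fock d H →L[ℂ] Fock d H') : IsFree (symbol T) := by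
  intro n m Z W X h
  ext1 i j
  refine ContinuousLinearMap.adjoint.injective (ContinuousLinearMap.ext fun u => ?_)
  have hk : ∑ k, kernelVec Z i k (conj (X k j) • u) = ∑ k, kernelVec W k j (conj (X i k) • u) := by
    ext α
    rw [lp.coeFn_sum, lp.coeFn_sum, Finset.sum_apply, Finset.sum_apply]
    have h2 := congrArg conj (congrFun (congrFun (Ball.word_intertwine h α) i) j)
    simp only [Matrix.mul_apply, map_sum, map_mul] at h2
    have h3 := congrArg (fun c : ℂ => c • u) h2
    simp only [Finset.sum_smul] at h3
    simp only [kernelVec_apply, smul_smul]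
    rw [h3]
    simp only [mul_comm]
  have h4 := congrArg (fun x => (lp.evalCLM ℂ (fun _ : FreeMonoid (Fin d) => H') 2 1) (T x)) hk
  simp only [map_sum] at h4
  simp only [mulScalar, scalarMul, Matrix.of_apply, map_sum, map_smulₛₗ,
    sum_apply, smul_apply, adjoint_symbol_apply]
  simp at h4
  exact h4

theorem isLeftSchur_symbol_of_apply_kernelVec {T : Fock d H →L[ℂ] Fock d H'}
    (hT : ∀ x, ‖T x‖ ≤ ‖x‖)
    (hk : ∀ (n : ℕ) (Z : Ball d n) (i j : Fin n) (h : H), T (kernelVec Z i j h) =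
      ∑ p, kernelVec Z p j (ContinuousLinearMap.adjoint (symbol T n Z i p) h)) :
    IsLeftSchur (symbol T) := by
  refine ⟨isFree_symbol T, fun x => ⟨ContinuousLinearMap.adjoint T x, ?_, fun n Z => ?_⟩⟩
  · refine (ContinuousLinearMap.le_opNorm _ x).trans (mul_le_of_le_one_left (norm_nonneg _) ?_)
    rw [LinearIsometryEquiv.norm_map]
    exact T.opNorm_le_bound zero_le_one (by simpa using hT)
  · ext1 i j
    refine ext_inner_left ℂ fun u => ?_
    rw [Fock.eval_apply, ContinuousLinearMap.adjoint_inner_right,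
      ContinuousLinearMap.adjoint_inner_right, hk, opApply, Matrix.of_apply, inner_sum, sum_inner]
    refine Finset.sum_congr rfl fun p _ => ?_
    rw [Fock.eval_apply, ← ContinuousLinearMap.adjoint_inner_left,
      ContinuousLinearMap.adjoint_inner_right]

theorem isRightSchur_symbol_of_apply_kernelVec {T : Fock d H →L[ℂ] Fock d H'}
    (hT : ∀ x, ‖T x‖ ≤ ‖x‖)
    (hk : ∀ (n : ℕ) (Z : Ball d n) (i j : Fin n) (h : H), T (kernelVec Z i j h) =
      ∑ p, kernelVec Z i p (ContinuousLinearMap.adjoint (symbol T n Z p j) h)) :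
    IsRightSchur (symbol T) := by
  refine ⟨isFree_symbol T, fun x => ⟨ContinuousLinearMap.adjoint T x, ?_, fun n Z => ?_⟩⟩
  · refine (ContinuousLinearMap.le_opNorm _ x).trans (mul_le_of_le_one_left (norm_nonneg _) ?_)
    rw [LinearIsometryEquiv.norm_map]
    exact T.opNorm_le_bound zero_le_one (by simpa using hT)
  · ext1 i j
    refine ext_inner_left ℂ fun u => ?_
    rw [Fock.eval_apply, ContinuousLinearMap.adjoint_inner_right,
      ContinuousLinearMap.adjoint_inner_right, hk, opApplyRight, Matrix.of_apply, inner_sum,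
      sum_inner]
    refine Finset.sum_congr rfl fun p _ => ?_
    rw [Fock.eval_apply, ← ContinuousLinearMap.adjoint_inner_left,
      ContinuousLinearMap.adjoint_inner_right]

theorem apply_kernelVec_of_rightShift {T : Fock d H →L[ℂ] Fock d H'}
    (hT : ∀ k x, T (backShift (rightSplit d) k x) = backShift (rightSplit d) k (T x))
    (i j : Fin n) (h : H) : T (kernelVec Z i j h) =
      ∑ p, kernelVec Z p j (ContinuousLinearMap.adjoint (symbol T n Z i p) h) := by
  have key : ∀ α : FreeMonoid (Fin d), ∀ j, T (kernelVec Z i j h) α =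
      ∑ p, conj (Z.word α p j) • T (kernelVec Z i p h) 1 := by
    refine split_induction (e := rightSplit d) (len := FreeMonoid.length)
      (fun k α => by simp) (fun j => ?_) fun k α ih j => ?_
    · simp [Matrix.one_apply]
    · rw [← backShift_apply, ← hT, backShift_right_kernelVec, map_sum, lp.coeFn_sum,
        Finset.sum_apply]
      simp only [map_smul, lp.coeFn_smul, Pi.smul_apply, ih, Finset.smul_sum, smul_smul,
        rightSplit_some, Ball.word_mul, Ball.word_of, Matrix.mul_apply, map_sum, map_mul,
        Finset.sum_smul]
      rw [Finset.sum_comm]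
      simp only [mul_comm]
  refine Subtype.ext (funext fun α => ?_)
  refine (key α j).trans ?_
  rw [lp.coeFn_sum, Finset.sum_apply]
  simp only [kernelVec_apply, adjoint_symbol_apply]

theorem apply_kernelVec_of_leftShift {T : Fock d H →L[ℂ] Fock d H'}
    (hT : ∀ k x, T (backShift (leftSplit d) k x) = backShift (leftSplit d) k (T x))
    (i j : Fin n) (h : H) : T (kernelVec Z i j h) =
      ∑ p, kernelVec Z i p (ContinuousLinearMap.adjoint (symbol T n Z p j) h) := by
  have key : ∀ α : FreeMonoid (Fin d), ∀ i, T (kernelVec Z i j h) α =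
      ∑ p, conj (Z.word α i p) • T (kernelVec Z p j h) 1 := by
    refine split_induction (e := leftSplit d) (len := FreeMonoid.length)
      (fun k α => by simp [add_comm]) (fun i => ?_) fun k α ih i => ?_
    · simp [Matrix.one_apply]
    · rw [← backShift_apply, ← hT, backShift_left_kernelVec, map_sum, lp.coeFn_sum,
        Finset.sum_apply]
      simp only [map_smul, lp.coeFn_smul, Pi.smul_apply, ih, Finset.smul_sum, smul_smul,
        leftSplit_some, Ball.word_mul, Ball.word_of, Matrix.mul_apply, map_sum, map_mul,
        Finset.sum_smul]
      rw [Finset.sum_comm]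
  refine Subtype.ext (funext fun α => ?_)
  refine (key α i).trans ?_
  rw [lp.coeFn_sum, Finset.sum_apply]
  simp only [kernelVec_apply, adjoint_symbol_apply]

theorem kernelComb_leftCoeff_single (i j : Fin n) (u : J) :
    kernelComb Z (leftCoeff A n Z (Pi.single j 1) (Pi.single i u)) =
      ∑ k, kernelVec Z k j (ContinuousLinearMap.adjoint (A n Z i k) u) := by
  have h1 : ∀ k l, leftCoeff A n Z (Pi.single j 1) (Pi.single i u) k l =
      if l = j then ContinuousLinearMap.adjoint (A n Z i k) u else 0 := by
    intro k l
    rw [leftCoeff, Matrix.of_apply, Finset.sum_eq_single i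
      (fun b _ hb => by rw [Pi.single_eq_of_ne hb, map_zero]) (by simp), Pi.single_eq_same]
    split_ifs with h
    · simp [h]
    · simp [Pi.single_eq_of_ne h]
  simp only [kernelComb, h1]
  refine Finset.sum_congr rfl fun k _ => ?_
  rw [Finset.sum_eq_single j (fun b _ hb => by rw [if_neg hb, map_zero]) (by simp), if_pos rfl]

theorem kernelComb_rightCoeff_single (i j : Fin n) (u : J) :
    kernelComb Z (rightCoeff A n Z (Pi.single j 1) (Pi.single i u)) =
      ∑ k, kernelVec Z i k (ContinuousLinearMap.adjoint (A n Z k j) u) := by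
  have h1 : ∀ l k, rightCoeff A n Z (Pi.single j 1) (Pi.single i u) l k =
      if l = i then ContinuousLinearMap.adjoint (A n Z k j) u else 0 := by
    intro l k
    rw [rightCoeff, Matrix.of_apply, Finset.sum_eq_single j
      (fun b _ hb => by rw [Pi.single_eq_of_ne hb, map_zero, zero_smul]) (by simp),
      Pi.single_eq_same, map_one, one_smul]
    split_ifs with h
    · simp [h]
    · simp [Pi.single_eq_of_ne h]
  simp only [kernelComb, h1]
  rw [Finset.sum_eq_single i (fun b _ hb => by simp [hb]) (by simp)]
  simp

theorem eq_opMul_symbol {B : GradedFun d (H →L[ℂ] J)} {A : GradedFun d (H' →L[ℂ] J)}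
    {T : Fock d H →L[ℂ] Fock d H'}
    (hT : ∀ n Z v y, T (kernelComb Z (leftCoeff B n Z v y)) = kernelComb Z (leftCoeff A n Z v y))
    (n : ℕ) (Z : Ball d n) : A n Z = opMul (B n Z) (symbol T n Z) := by
  ext1 i j
  refine ContinuousLinearMap.adjoint.injective (ContinuousLinearMap.ext fun u => ?_)
  have h := congrArg (lp.evalCLM ℂ (fun _ : FreeMonoid (Fin d) => H') 2 1)
    (hT n Z (Pi.single j 1) (Pi.single i u))
  rw [kernelComb_leftCoeff_single, kernelComb_leftCoeff_single, map_sum, map_sum, map_sum] at h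
  have e1 : ∀ x : Fock d H', lp.evalCLM ℂ (fun _ : FreeMonoid (Fin d) => H') 2 1 x = x 1 :=
    fun _ => rfl
  simp only [e1, ← adjoint_symbol_apply, kernelVec_apply, Ball.word_one] at h
  rw [opMul, Matrix.of_apply, map_sum, sum_apply]
  simp only [ContinuousLinearMap.adjoint_comp, ContinuousLinearMap.comp_apply]
  rw [h, Finset.sum_eq_single j (fun b _ hb => by simp [hb]) (by simp)]
  simp

theorem eq_opMulRight_symbol {B : GradedFun d (H →L[ℂ] J)} {A : GradedFun d (H' →L[ℂ] J)}
    {T : Fock d H →L[ℂ] Fock d H'}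
    (hT : ∀ n Z v y, T (kernelComb Z (rightCoeff B n Z v y)) = kernelComb Z (rightCoeff A n Z v y))
    (n : ℕ) (Z : Ball d n) : A n Z = opMulRight (B n Z) (symbol T n Z) := by
  ext1 i j
  refine ContinuousLinearMap.adjoint.injective (ContinuousLinearMap.ext fun u => ?_)
  have h := congrArg (lp.evalCLM ℂ (fun _ : FreeMonoid (Fin d) => H') 2 1)
    (hT n Z (Pi.single j 1) (Pi.single i u))
  rw [kernelComb_rightCoeff_single, kernelComb_rightCoeff_single, map_sum, map_sum, map_sum] at h
  have e1 : ∀ x : Fock d H', lp.evalCLM ℂ (fun _ : FreeMonoid (Fin d) => H') 2 1 x = x 1 :=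
    fun _ => rfl
  simp only [e1, ← adjoint_symbol_apply, kernelVec_apply, Ball.word_one] at h
  rw [opMulRight, Matrix.of_apply, map_sum, sum_apply]
  simp only [ContinuousLinearMap.adjoint_comp, ContinuousLinearMap.comp_apply]
  rw [h, Finset.sum_eq_single i (fun b _ hb => by simp [hb.symm]) (by simp)]
  simp

theorem exists_left_factor {A : GradedFun d (H' →L[ℂ] J)} {B : GradedFun d (H →L[ℂ] J)}
    (hA : IsFree A) (hB : IsFree B) (h : IsCPNC (leftKernel B - leftKernel A)) :
    ∃ C : GradedFun d (H' →L[ℂ] H), IsLeftSchur C ∧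
      ∀ (n : ℕ) (Z : Ball d n), A n Z = opMul (B n Z) (C n Z) := by
  obtain ⟨T, hT, hTk, hTe⟩ := exists_lift_kernelComb (e := rightSplit d) rfl
    (fun k α => by simp) (isDirectSumFamily_leftCoeff hB) (isDirectSumFamily_leftCoeff hA)
    (fun n Z v y => norm_le_of_isCPNC h Z v y (inner_kernelComb_leftCoeff B Z v y)
      (inner_kernelComb_leftCoeff A Z v y))
    (fun n Z v y k => ⟨_, _, backShift_leftCoeff B Z v y k, backShift_leftCoeff A Z v y k⟩)
  exact ⟨symbol T, isLeftSchur_symbol_of_apply_kernelVec hT fun n Z =>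
    apply_kernelVec_of_rightShift Z hTe, eq_opMul_symbol hTk⟩

theorem exists_right_factor {A : GradedFun d (H' →L[ℂ] J)} {B : GradedFun d (H →L[ℂ] J)}
    (hA : IsFree A) (hB : IsFree B) (h : IsCPNC (rightKernel B - rightKernel A)) :
    ∃ C : GradedFun d (H' →L[ℂ] H), IsRightSchur C ∧
      ∀ (n : ℕ) (Z : Ball d n), A n Z = opMulRight (B n Z) (C n Z) := by
  obtain ⟨T, hT, hTk, hTe⟩ := exists_lift_kernelComb (e := leftSplit d) rfl
    (fun k α => by simp [add_comm]) (isDirectSumFamily_rightCoeff hB)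
    (isDirectSumFamily_rightCoeff hA)
    (fun n Z v y => norm_le_of_isCPNC h Z v y (inner_kernelComb_rightCoeff B Z v y)
      (inner_kernelComb_rightCoeff A Z v y))
    (fun n Z v y k => ⟨_, _, backShift_rightCoeff B Z v y k, backShift_rightCoeff A Z v y k⟩)
  exact ⟨symbol T, isRightSchur_symbol_of_apply_kernelVec hT fun n Z =>
    apply_kernelVec_of_leftShift Z hTe, eq_opMulRight_symbol hTk⟩

end Coefficients

end FreeHardy

end

theorem corollary6p2 (d : ℕ) {H₁ H₂ J : Type*}
    [NormedAddCommGroup H₁] [InnerProductSpace ℂ H₁] [CompleteSpace H₁]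
    [NormedAddCommGroup H₂] [InnerProductSpace ℂ H₂] [CompleteSpace H₂]
    [NormedAddCommGroup J] [InnerProductSpace ℂ J] [CompleteSpace J]
    (A : FreeHardy.GradedFun d (H₁ →L[ℂ] J)) (B : FreeHardy.GradedFun d (H₂ →L[ℂ] J))
    (hA : FreeHardy.IsFree A) (hB : FreeHardy.IsFree B) :
    (FreeHardy.IsCPNC (FreeHardy.leftKernel B - FreeHardy.leftKernel A) →
      ∃ C : FreeHardy.GradedFun d (H₁ →L[ℂ] H₂), FreeHardy.IsLeftSchur C ∧
        ∀ (n : ℕ) (Z : FreeHardy.Ball d n), A n Z = FreeHardy.opMul (B n Z) (C n Z)) ∧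
    (FreeHardy.IsCPNC (FreeHardy.rightKernel B - FreeHardy.rightKernel A) →
      ∃ C : FreeHardy.GradedFun d (H₁ →L[ℂ] H₂), FreeHardy.IsRightSchur C ∧
        ∀ (n : ℕ) (Z : FreeHardy.Ball d n), A n Z = FreeHardy.opMulRight (B n Z) (C n Z)) :=
  ⟨FreeHardy.exists_left_factor hA hB, FreeHardy.exists_right_factor hA hB⟩
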